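/- Define $L(1)=L(2)=1$, $L(3)=L(4)=2$ and $L(i)=\lceil\log_4 i\rceil$ for $i\ge 5$. Let $\lambda\in(1/2,1)$, and let $N_0,N_1,\dots,N_n$ be natural numbers with $N_0=2$ and $N_i\ge 1$ for $i\ge1$. A coral $G_n$ with parameters $\lambda$ and $\{N_i\}_{i=0}^n$ is a weighted graph obtained as follows. $G_0=(V_0,E_0)$ consists of two vertices joined by one edge of weight $1$. Given $G_k$ with vertex set $\bigcup_{i=0}^kV_i$ and edge set $\bigcup_{i=0}^kE_i$, the graph $G_{k+1}$ is obtained by adding a set $V_{k+1}$ of $N_{k+1}$ new vertices and a set $E_{k+1}$ of new edges, each of weight $\lambda^{k+1}$ and each joining a vertex of $V_{k+1}$ to a vertex of $\bigcup_{i=0}^kV_i$, in such a way that every $v\in V_{k+1}$ has degree $1$ or $2$ in $G_{k+1}$ and, if $v$ has degree $2$, its two neighbours $u,w$ are joined by an edge $uw\in E_k$. (A vertex of degree $1$ may be attached to any vertex of $G_k$.) The vertex set of $G_n$ is endowed with the weighted shortest path metric. A finite basic sequence $x_1,\dots,x_\ell$ in a Banach space is a linearly independent sequence; its basis constant is the least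 $K$ such that $\bigl\|\sum_{i\le m}a_ix_i\bigr\|\le K\bigl\|\sum_{i\le \ell}a_ix_i\bigr\|$ for all $m\le\ell$ and all scalars $a_1,\dots,a_\ell$. A metric space $(M,d)$ $D$-embeds into a Banach space $X$ if there is an injective map $f:M\to X$ with $$\sup_{p\ne q}\frac{\|f(p)-f(q)\|}{d(p,q)}\cdot\sup_{p\ne q}\frac{d(p,q)}{\|f(p)-f(q)\|}\le D .$$ Theorem. Let $C\ge1$ and $\lambda\in(1/2,1)$. Then there exists a constant $D=D(C,\lambda)$ such that, for every $n\ge0$, every coral $G_n$ with parameters $\lambda$ and $\{N_i\}_{i=0}^n$ $D$-embeds into any (real or complex) Banach space which contains a basic sequence of length $\sum_{i=0}^nL(N_i)$ with basis constant $\le C$. -/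

import Mathlib

open scoped ENNReal

noncomputable section

/-- A coral `G_n` with parameters `lam` and `N_0, ..., N_n`, on the vertex type `V`.
The function `gen` records the step at which a vertex is introduced, so that
`V_k = {v | gen v = k}`. Every edge is introduced together with its younger end, i.e. the edges
with maximal end generation `k` are those of `E_k`. -/
structure Coral (lam : ℝ) (n : ℕ) (N : ℕ → ℕ) (V : Type*) where
  lam_mem : lam ∈ Set.Ioo (1 / 2 : ℝ) 1
  N_zero : N 0 = 2
  one_le_N : ∀ i, 1 ≤ i → i ≤ n → 1 ≤ N i
  graph : SimpleGraph V
  gen : V → ℕ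
  gen_le : ∀ v, gen v ≤ n
  /-- `|V_i| = N_i` (in particular all `V_i` are finite, as `N_i ≥ 1`). -/
  card_gen : ∀ i, i ≤ n → {v | gen v = i}.ncard = N i
  /-- The two vertices of `V_0` are joined by an edge. -/
  adj_of_gen_zero : ∀ u v, gen u = 0 → gen v = 0 → u ≠ v → graph.Adj u v
  /-- For `k ≥ 1` the edges of `E_k` join vertices of `V_k` with strictly older vertices. -/
  gen_ne_of_adj : ∀ u v, graph.Adj u v → gen u ≠ 0 → gen u ≠ gen v
  /-- For `k ≥ 1` every vertex of `V_k` is attached, when it appears, to one or two vertices. -/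
  degree : ∀ v, gen v ≠ 0 →
    {u | graph.Adj v u ∧ gen u < gen v}.ncard = 1 ∨ {u | graph.Adj v u ∧ gen u < gen v}.ncard = 2
  /-- If a vertex of `V_{k+1}` is attached to two vertices `u`, `w`, then `uw` is an edge
  of `E_k`. -/
  adj_of_attached : ∀ v u w, u ≠ w → graph.Adj v u → gen u < gen v → graph.Adj v w →
    gen w < gen v → graph.Adj u w ∧ max (gen u) (gen w) + 1 = gen v

namespace Coral

variable {lam : ℝ} {n : ℕ} {N : ℕ → ℕ} {V : Type*} (G : Coral lam n N V)

/-- The weight of an edge with ends `u`, `v`: `lam ^ k` for the edges of `E_k`. -/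
def weight (u v : V) : ℝ := lam ^ max (G.gen u) (G.gen v)

/-- The total weight of a walk. -/
def walkLength {u v : V} (p : G.graph.Walk u v) : ℝ :=
  (p.darts.map fun d => G.weight d.fst d.snd).sum

/-- The weighted shortest path distance. -/
def pathDist (u v : V) : ℝ := ⨅ p : G.graph.Walk u v, G.walkLength p

theorem lam_pos (G : Coral lam n N V) : 0 < lam := lt_trans (by norm_num) G.lam_mem.1

theorem weight_pos (u v : V) : 0 < G.weight u v := pow_pos G.lam_pos _

theorem walkLength_nonneg {u v : V} (p : G.graph.Walk u v) : 0 ≤ G.walkLength p := by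
  apply List.sum_nonneg
  intro x hx
  obtain ⟨d, -, rfl⟩ := List.mem_map.1 hx
  exact (G.weight_pos _ _).le

theorem walkLength_append {u v w : V} (p : G.graph.Walk u v) (q : G.graph.Walk v w) :
    G.walkLength (p.append q) = G.walkLength p + G.walkLength q := by
  simp [walkLength]

theorem walkLength_reverse {u v : V} (p : G.graph.Walk u v) :
    G.walkLength p.reverse = G.walkLength p := by
  simp [walkLength, Function.comp_def, weight, max_comm, List.sum_reverse]

theorem reachable_of_gen_zero {r : V} (hr : G.gen r = 0) (v : V) : G.graph.Reachable r v := by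
  induction h : G.gen v using Nat.strong_induction_on generalizing v with
  | _ k ih =>
    by_cases hv : G.gen v = 0
    · by_cases hrv : r = v
      · exact hrv ▸ SimpleGraph.Reachable.refl _
      · exact (G.adj_of_gen_zero r v hr hv hrv).reachable
    · have hne : {u | G.graph.Adj v u ∧ G.gen u < G.gen v}.Nonempty := by
        rw [Set.nonempty_iff_ne_empty]
        intro he
        have := G.degree v hv
        rw [he] at this
        simp at this
      obtain ⟨u, hu, hlt⟩ := hne
      exact (ih (G.gen u) (h ▸ hlt) u rfl).trans hu.symm.reachable

theorem reachable (u v : V) : G.graph.Reachable u v := by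
  have h : {v | G.gen v = 0}.ncard = 2 := (G.card_gen 0 (Nat.zero_le _)).trans G.N_zero
  obtain ⟨r, hr⟩ : {v | G.gen v = 0}.Nonempty := by
    rw [Set.nonempty_iff_ne_empty]
    intro he
    simp [he] at h
  exact (G.reachable_of_gen_zero hr u).symm.trans (G.reachable_of_gen_zero hr v)

instance (u v : V) : Nonempty (G.graph.Walk u v) := G.reachable u v

theorem bddBelow_walkLength (u v : V) :
    BddBelow (Set.range fun p : G.graph.Walk u v => G.walkLength p) :=
  ⟨0, by rintro _ ⟨p, rfl⟩; exact G.walkLength_nonneg p⟩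

theorem pathDist_le {u v : V} (p : G.graph.Walk u v) : G.pathDist u v ≤ G.walkLength p :=
  ciInf_le (G.bddBelow_walkLength u v) p

theorem pathDist_self (u : V) : G.pathDist u u = 0 :=
  le_antisymm ((G.pathDist_le SimpleGraph.Walk.nil).trans_eq (by simp [walkLength]))
    (le_ciInf fun p => G.walkLength_nonneg p)

theorem pathDist_comm (u v : V) : G.pathDist u v = G.pathDist v u :=
  le_antisymm
    (le_ciInf fun p => (G.pathDist_le p.reverse).trans_eq (G.walkLength_reverse p))
    (le_ciInf fun p => (G.pathDist_le p.reverse).trans_eq (G.walkLength_reverse p))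

theorem pathDist_triangle (u v w : V) : G.pathDist u w ≤ G.pathDist u v + G.pathDist v w :=
  le_ciInf_add_ciInf fun p q => (G.pathDist_le (p.append q)).trans_eq (G.walkLength_append p q)

theorem eq_of_pathDist_eq_zero {u v : V} (h : G.pathDist u v = 0) : u = v := by
  by_contra hne
  have hle : lam ^ n ≤ G.pathDist u v := by
    refine le_ciInf fun p => ?_
    cases p with
    | nil => exact absurd rfl hne
    | @cons _ b _ hadj q =>
      have h0 := G.walkLength_nonneg q
      have h1 : lam ^ n ≤ G.weight u b :=
        pow_le_pow_of_le_one G.lam_pos.le G.lam_mem.2.le (max_le (G.gen_le _) (G.gen_le _))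
      calc lam ^ n ≤ G.weight u b + G.walkLength q := le_add_of_le_of_nonneg h1 h0
        _ = _ := by simp [walkLength]
  exact absurd h (ne_of_gt ((pow_pos G.lam_pos n).trans_le hle))

/-- The vertex set of a coral, regarded as a metric space. -/
def Points (_ : Coral lam n N V) : Type _ := V

/-- A coral carries the weighted shortest path metric. -/
instance : MetricSpace G.Points where
  dist := G.pathDist
  dist_self := G.pathDist_self
  dist_comm := G.pathDist_comm
  dist_triangle := G.pathDist_triangle
  eq_of_dist_eq_zero := G.eq_of_pathDist_eq_zero

end Coral

/-- The distortion of a map between metric spaces (meant for injective maps). -/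
def distortion {X Y : Type*} [MetricSpace X] [MetricSpace Y] (f : X → Y) : ℝ≥0∞ :=
  (⨆ (x : X) (y : X) (_ : x ≠ y), edist (f x) (f y) / edist x y) *
    (⨆ (x : X) (y : X) (_ : x ≠ y), edist x y / edist (f x) (f y))

/-- `X` embeds into `Y` with distortion at most `D`. -/
def EmbedsWithDistortion (D : ℝ) (X Y : Type*) [MetricSpace X] [MetricSpace Y] : Prop :=
  ∃ f : X → Y, Function.Injective f ∧ distortion f ≤ ENNReal.ofReal D

/-- `x` is a (finite) basic sequence, i.e. a basis of its linear span, whose basis constant, the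
largest norm of a partial sum projection on that span, is at most `C`. -/
def IsBasicSequence (𝕜 : Type*) [RCLike 𝕜] {X : Type*} [NormedAddCommGroup X] [NormedSpace 𝕜 X]
    (C : ℝ) {l : ℕ} (x : Fin l → X) : Prop :=
  LinearIndependent 𝕜 x ∧
    ∀ (m : ℕ) (a : Fin l → 𝕜), ‖∑ i with i.val < m, a i • x i‖ ≤ C * ‖∑ i, a i • x i‖

/-- The function `L` on positive integers (the value at `0` is irrelevant). -/
def coralL (i : ℕ) : ℕ :=
  if i ≤ 2 then 1 else if i ≤ 4 then 2 else ⌈Real.logb 4 i⌉₊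

end

/-!
The embedding sends a vertex `p` of generation `k ≥ 1` to the mean of the images of the vertices to
which it was attached, plus `lam ^ k` times a unit vector `y p`. The vectors `y p` of generation `k`
lie in the span of the `k`-th block of the basic sequence and are pairwise separated by a fixed
amount; a volume argument provides that many separated points on a sphere
(`exists_separated_units`), except for the blocks of length one, where one or two antipodal points
suffice. For positive multiples of these vectors not to be close, it matters that they have norm
exactly one.

Since `lam > 1/2`, the Lipschitz bound propagates along edges: halving the increment of an older
edge and adding `lam ^ k` does not exceed the constant times the shorter weight
(`Coral.norm_embed_sub_le_weight`).

For the lower bound the images are read off from the random walk that moves from each vertex to one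
of its parents with probability `1/2` each. The component of generation `k` of the image of `p` is
`lam ^ k` times the mean of `y` over the vertices of generation `k` at which this walk enters the
set of vertices of generation at most `k`. As two distinct parents of a vertex are joined by an edge
of the previous generation, the hitting distribution `Coral.hit` is carried by a single vertex or
edge (`Coral.exists_segment`), hence charges at most one vertex of generation `k` when `k ≥ 1`; the
component detects this vertex and its weight. If the components of `p` and `q` are close for all
generations up to `k`, then an induction on `k` shows that the hitting distributions cannot
concentrate at different vertices (`Coral.eq_of_hit_ge`), and so they have a common vertex in their
supports (`Coral.exists_common_of_closeAt`). The walks from `p` and `q` to that vertex have lengths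
at most `lam ^ (k + 1) / (1 - lam)`. So at the first generation `k` where the components differ they
differ by a multiple of `lam ^ k`, while `p` and `q` are at distance at most `2 * lam ^ k / (1 -
lam)`; and the projections onto the blocks are bounded by twice the basis constant.
-/

noncomputable section

namespace Coral

variable {lam : ℝ} {n : ℕ} {N : ℕ → ℕ} {V : Type*} (G : Coral lam n N V)

/-! ### Parents and hitting distributions -/

theorem exists_parents (v : V) (hv : G.gen v ≠ 0) :
    ∃ a b, (G.graph.Adj v a ∧ G.gen a < G.gen v) ∧ (G.graph.Adj v b ∧ G.gen b < G.gen v) ∧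
      ∀ u, G.graph.Adj v u → G.gen u < G.gen v → u = a ∨ u = b := by
  rcases G.degree v hv with h | h
  · obtain ⟨a, ha⟩ := Set.ncard_eq_one.1 h
    have h1 : ∀ u, (G.graph.Adj v u ∧ G.gen u < G.gen v) ↔ u = a := fun u => by
      simpa using Set.ext_iff.1 ha u
    exact ⟨a, a, (h1 a).2 rfl, (h1 a).2 rfl, fun u hu hu' => Or.inl ((h1 u).1 ⟨hu, hu'⟩)⟩
  · obtain ⟨a, b, -, hab⟩ := Set.ncard_eq_two.1 h
    have h1 : ∀ u, (G.graph.Adj v u ∧ G.gen u < G.gen v) ↔ u = a ∨ u = b := fun u => by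
      simpa using Set.ext_iff.1 hab u
    exact ⟨a, b, (h1 a).2 (Or.inl rfl), (h1 b).2 (Or.inr rfl), fun u hu hu' => (h1 u).1 ⟨hu, hu'⟩⟩

/-- One of the vertices to which `v` is attached when it appears (`v` itself in generation `0`). -/
def parentA (v : V) : V := if h : G.gen v ≠ 0 then (G.exists_parents v h).choose else v

/-- The other vertex to which `v` is attached when it appears; it equals `parentA v` if there is
only one (and `v` itself in generation `0`). -/
def parentB (v : V) : V :=
  if h : G.gen v ≠ 0 then (G.exists_parents v h).choose_spec.choose else v

theorem parents_spec {v : V} (hv : G.gen v ≠ 0) :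
    (G.graph.Adj v (G.parentA v) ∧ G.gen (G.parentA v) < G.gen v) ∧
      (G.graph.Adj v (G.parentB v) ∧ G.gen (G.parentB v) < G.gen v) ∧
      ∀ u, G.graph.Adj v u → G.gen u < G.gen v → u = G.parentA v ∨ u = G.parentB v := by
  simp only [parentA, parentB, dif_pos hv]
  exact (G.exists_parents v hv).choose_spec.choose_spec

theorem parents_eq_or_adj {v : V} (hv : G.gen v ≠ 0) :
    G.parentA v = G.parentB v ∨ G.graph.Adj (G.parentA v) (G.parentB v) ∧
      max (G.gen (G.parentA v)) (G.gen (G.parentB v)) + 1 = G.gen v := by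
  obtain ⟨⟨h1, h2⟩, ⟨h3, h4⟩, -⟩ := G.parents_spec hv
  by_cases h : G.parentA v = G.parentB v
  · exact Or.inl h
  · exact Or.inr (G.adj_of_attached v _ _ h h1 h2 h3 h4)

open Classical in
/-- The hitting distribution `hit k p` on the vertices of generation at most `k`: the random walk
started at `p` that moves from each vertex to one of its two parents, with probability `1/2` each,
enters the set of these vertices at `v` with probability `hit k p v`. -/
def hit (k : ℕ) (p : V) : V → ℝ :=
  if h : G.gen p ≤ k then Pi.single p 1
  else fun v => (hit k (G.parentA p) v + hit k (G.parentB p) v) / 2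
termination_by G.gen p
decreasing_by
  · exact (G.parents_spec (by omega)).1.2
  · exact (G.parents_spec (by omega)).2.1.2

open Classical in
theorem hit_of_le {k : ℕ} {p : V} (h : G.gen p ≤ k) : G.hit k p = Pi.single p 1 := by
  rw [hit, dif_pos h]

theorem hit_self {k : ℕ} {p : V} (h : G.gen p ≤ k) : G.hit k p p = 1 := by
  rw [G.hit_of_le h]; simp

theorem hit_of_ne {k : ℕ} {p v : V} (h : G.gen p ≤ k) (hv : v ≠ p) : G.hit k p v = 0 := by
  rw [G.hit_of_le h]; simp [hv]

theorem hit_of_lt {k : ℕ} {p : V} (h : k < G.gen p) (v : V) :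
    G.hit k p v = (G.hit k (G.parentA p) v + G.hit k (G.parentB p) v) / 2 := by
  rw [hit, dif_neg (not_le.2 h)]

/-- Induction along the random walk towards the vertices of generation at most `k`. -/
theorem hit_induction (k : ℕ) {P : V → Prop} (base : ∀ p, G.gen p ≤ k → P p)
    (step : ∀ p, k < G.gen p → P (G.parentA p) → P (G.parentB p) → P p) (p : V) : P p := by
  induction h : G.gen p using Nat.strong_induction_on generalizing p with
  | _ j ih =>
    by_cases hp : G.gen p ≤ k
    · exact base p hp
    · have hs := G.parents_spec (v := p) (by omega)
      exact step p (by omega) (ih _ (h ▸ hs.1.2) _ rfl) (ih _ (h ▸ hs.2.1.2) _ rfl)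

theorem hit_nonneg (k : ℕ) (p v : V) : 0 ≤ G.hit k p v := by
  induction p using G.hit_induction k with
  | base p hp =>
    by_cases hv : v = p
    · rw [hv, G.hit_self hp]; exact zero_le_one
    · rw [G.hit_of_ne hp hv]
  | step p hp h1 h2 => rw [G.hit_of_lt hp]; positivity

theorem hit_le_hit_of_le {k l : ℕ} (hkl : k ≤ l) {p v : V} (hv : G.gen v ≤ k) :
    G.hit l p v ≤ G.hit k p v := by
  induction p using G.hit_induction l with
  | base p hp =>
    by_cases h : v = p
    · rw [← h, G.hit_self hv, G.hit_self (hv.trans hkl)]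
    · rw [G.hit_of_ne hp h]; exact G.hit_nonneg _ _ _
  | step p hp h1 h2 =>
    rw [G.hit_of_lt hp, G.hit_of_lt (hkl.trans_lt hp)]; linarith

theorem gen_le_of_hit_ne_zero {k : ℕ} {p v : V} (h : G.hit k p v ≠ 0) : G.gen v ≤ k := by
  induction p using G.hit_induction k with
  | base p hp =>
    by_cases hv : v = p
    · rwa [hv]
    · exact absurd (G.hit_of_ne hp hv) h
  | step p hp h1 h2 =>
    by_contra hv
    rw [G.hit_of_lt hp, not_not.1 (mt h1 hv), not_not.1 (mt h2 hv)] at h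
    simp at h

theorem hit_add_hit_le_one (k : ℕ) (p : V) {u v : V} (huv : u ≠ v) :
    G.hit k p u + G.hit k p v ≤ 1 := by
  induction p using G.hit_induction k with
  | base p hp =>
    by_cases hu : u = p
    · rw [G.hit_of_ne hp (fun h : v = p => huv (hu.trans h.symm)), hu, G.hit_self hp, add_zero]
    · by_cases hv : v = p
      · rw [G.hit_of_ne hp hu, hv, G.hit_self hp, zero_add]
      · rw [G.hit_of_ne hp hu, G.hit_of_ne hp hv]; norm_num
  | step p hp h1 h2 => rw [G.hit_of_lt hp, G.hit_of_lt hp]; linarith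

open Classical in
/-- A convex combination of the hitting distributions of the two ends of an edge of generation at
least `k` is carried by an edge of `E_k` or by a single vertex: the edge of a vertex with two
parents is folded onto the edge between these parents. -/
theorem exists_segment (k : ℕ) (u w : V)
    (huw : u = w ∨ G.graph.Adj u w ∧ k ≤ max (G.gen u) (G.gen w)) (s : ℝ) (h0 : 0 ≤ s)
    (h1 : s ≤ 1) :
    ∃ (u' w' : V) (s' : ℝ), 0 ≤ s' ∧ s' ≤ 1 ∧ G.gen u' ≤ k ∧ G.gen w' ≤ k ∧
      (u' = w' ∨ G.graph.Adj u' w' ∧ max (G.gen u') (G.gen w') = k) ∧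
      (1 - s) • G.hit k u + s • G.hit k w =
        (1 - s') • Pi.single u' (1 : ℝ) + s' • Pi.single w' (1 : ℝ) := by
  induction h : max (G.gen u) (G.gen w) using Nat.strong_induction_on generalizing u w s with
  | _ j ih =>
    wlog hle : G.gen u ≤ G.gen w generalizing u w s
    · obtain ⟨u', w', s', h⟩ := this w u
        (huw.imp Eq.symm fun h => ⟨h.1.symm, by rw [max_comm]; exact h.2⟩) (1 - s) (by linarith)
        (by linarith) (by rwa [max_comm]) (by omega)
      refine ⟨u', w', s', ?_⟩
      rwa [sub_sub_cancel, add_comm (s • _)] at h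
    rw [max_eq_right hle] at h huw
    by_cases hw : G.gen w ≤ k
    · refine ⟨u, w, s, h0, h1, hle.trans hw, hw, huw.imp id fun h => ⟨h.1, ?_⟩, ?_⟩
      · rw [max_eq_right hle]; exact le_antisymm hw h.2
      · rw [G.hit_of_le (hle.trans hw), G.hit_of_le hw]
    · rw [not_le] at hw
      have hw0 : G.gen w ≠ 0 := by omega
      obtain ⟨⟨a1, a2⟩, ⟨b1, b2⟩, hall⟩ := G.parents_spec hw0
      rcases huw with rfl | ⟨hadj, -⟩
      · obtain ⟨u', w', s', h2, h3, h4, h5, h6, h7⟩ := ih _ (h ▸ max_lt a2 b2) (G.parentA u)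
          (G.parentB u) ((G.parents_eq_or_adj hw0).imp id fun h => ⟨h.1, by omega⟩) (1 / 2)
          (by norm_num) (by norm_num) rfl
        refine ⟨u', w', s', h2, h3, h4, h5, h6, h7 ▸ ?_⟩
        ext v
        simp only [Pi.add_apply, Pi.smul_apply, smul_eq_mul, G.hit_of_lt hw]
        ring
      · have hlt : G.gen u < G.gen w :=
          lt_of_le_of_ne hle (G.gen_ne_of_adj w u hadj.symm hw0).symm
        -- `c` is the parent of `w` other than `u` (or `u`, if that is the only one).
        obtain ⟨c, c1, c2, hc⟩ : ∃ c, G.graph.Adj w c ∧ G.gen c < G.gen w ∧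
            ∀ v, G.hit k w v = (G.hit k u v + G.hit k c v) / 2 := by
          rcases hall u hadj.symm hlt with rfl | rfl
          · exact ⟨_, b1, b2, G.hit_of_lt hw⟩
          · exact ⟨_, a1, a2, fun v => by rw [G.hit_of_lt hw, add_comm]⟩
        have huc : u = c ∨ G.graph.Adj u c ∧ k ≤ max (G.gen u) (G.gen c) := by
          by_cases huc : u = c
          · exact Or.inl huc
          · have := G.adj_of_attached w u c huc hadj.symm hlt c1 c2
            exact Or.inr ⟨this.1, by omega⟩
        obtain ⟨u', w', s', h2, h3, h4, h5, h6, h7⟩ := ih _ (h ▸ max_lt hlt c2) u c huc (s / 2)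
          (by linarith) (by linarith) rfl
        refine ⟨u', w', s', h2, h3, h4, h5, h6, h7 ▸ ?_⟩
        ext v
        simp only [Pi.add_apply, Pi.smul_apply, smul_eq_mul, hc]
        ring

theorem ncard_gen_ne_zero {k : ℕ} (hk : k ≤ n) : {v | G.gen v = k}.ncard ≠ 0 := by
  rw [G.card_gen k hk]
  rcases Nat.eq_zero_or_pos k with rfl | h
  · simp [G.N_zero]
  · exact Nat.one_le_iff_ne_zero.1 (G.one_le_N k h hk)

theorem exists_gen_eq {k : ℕ} (hk : k ≤ n) : ∃ v, G.gen v = k :=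
  Set.nonempty_of_ncard_ne_zero (G.ncard_gen_ne_zero hk)

open Classical in
/-- At a positive generation `k` the hitting distribution charges only one vertex of generation
`k` and one older vertex. -/
theorem exists_hit_eq {k : ℕ} (hk : k ≠ 0) (hkn : k ≤ n) (p : V) :
    ∃ (u w : V) (s : ℝ), 0 ≤ s ∧ s ≤ 1 ∧ G.gen u < k ∧ G.gen w = k ∧
      G.hit k p = (1 - s) • Pi.single u (1 : ℝ) + s • Pi.single w (1 : ℝ) := by
  obtain ⟨u, w, s, h0, h1, hu, hw, huw, h⟩ := G.exists_segment k p p (Or.inl rfl) 0 le_rfl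
    zero_le_one
  simp only [sub_zero, one_smul, zero_smul, add_zero] at h
  rw [h]
  rcases huw with rfl | ⟨hadj, hmax⟩
  · rcases hu.lt_or_eq with hlt | heq
    · obtain ⟨w, hw⟩ := G.exists_gen_eq hkn
      refine ⟨u, w, 0, le_rfl, zero_le_one, hlt, hw, ?_⟩
      rw [← add_smul]; simp
    · obtain ⟨r, hr⟩ := G.exists_gen_eq (Nat.zero_le n)
      refine ⟨r, u, 1, zero_le_one, le_rfl, by omega, heq, ?_⟩
      rw [← add_smul]; simp
  · by_cases hgw : G.gen w = k
    · exact ⟨u, w, s, h0, h1, lt_of_le_of_ne hu fun hgu =>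
        G.gen_ne_of_adj u w hadj (by omega) (by omega), hgw, rfl⟩
    · refine ⟨w, u, 1 - s, by linarith, by linarith, by omega, by omega, ?_⟩
      rw [sub_sub_cancel, add_comm]

open Classical in
theorem exists_hit_zero_eq : ∃ a b, a ≠ b ∧ (∀ v, G.gen v = 0 ↔ v = a ∨ v = b) ∧ ∀ p, ∃ s : ℝ,
    G.hit 0 p = (1 - s) • Pi.single a (1 : ℝ) + s • Pi.single b (1 : ℝ) := by
  obtain ⟨a, b, hab, h⟩ := Set.ncard_eq_two.1 ((G.card_gen 0 (Nat.zero_le _)).trans G.N_zero)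
  have hg : ∀ v, G.gen v = 0 ↔ v = a ∨ v = b := fun v => by simpa using Set.ext_iff.1 h v
  refine ⟨a, b, hab, hg, fun p => ?_⟩
  induction p using G.hit_induction 0 with
  | base p hp =>
    rcases (hg p).1 (Nat.le_zero.1 hp) with rfl | rfl
    · exact ⟨0, by rw [G.hit_of_le hp]; simp⟩
    · exact ⟨1, by rw [G.hit_of_le hp]; simp⟩
  | step p hp h1 h2 =>
    obtain ⟨s, hs⟩ := h1
    obtain ⟨t, ht⟩ := h2
    refine ⟨(s + t) / 2, ?_⟩
    ext v
    rw [G.hit_of_lt hp, hs, ht]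
    simp only [Pi.add_apply, Pi.smul_apply, smul_eq_mul]
    ring

/-! ### Hitting distributions and distances -/

theorem pathDist_le_weight {u v : V} (h : G.graph.Adj u v) : G.pathDist u v ≤ G.weight u v :=
  (G.pathDist_le h.toWalk).trans_eq (by simp [walkLength])

theorem lam_lt_one (G : Coral lam n N V) : lam < 1 := G.lam_mem.2

theorem pathDist_le_of_hit_ne_zero {k : ℕ} {p z : V} (h : G.hit k p z ≠ 0) :
    G.pathDist p z ≤ lam ^ (k + 1) / (1 - lam) := by
  have hl := sub_pos.2 G.lam_lt_one
  have hp := G.lam_pos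
  -- The steps of the random walk have lengths `lam ^ j` with distinct exponents `j > k`.
  have key : (p = z ∧ G.gen p ≤ k) ∨
      G.pathDist p z ≤ (lam ^ (k + 1) - lam ^ (G.gen p + 1)) / (1 - lam) ∧ k < G.gen p := by
    induction p using G.hit_induction k with
    | base p hp =>
      by_cases hz : z = p
      · exact Or.inl ⟨hz.symm, hp⟩
      · exact absurd (G.hit_of_ne hp hz) h
    | step p hkp h1 h2 =>
      refine Or.inr ⟨?_, hkp⟩
      have hp0 : G.gen p ≠ 0 := by omega
      obtain ⟨a1, b1, -⟩ := G.parents_spec hp0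
      obtain ⟨c, ⟨c1, c2⟩, hc⟩ : ∃ c, (G.graph.Adj p c ∧ G.gen c < G.gen p) ∧
          ((c = z ∧ G.gen c ≤ k) ∨
            G.pathDist c z ≤ (lam ^ (k + 1) - lam ^ (G.gen c + 1)) / (1 - lam) ∧
              k < G.gen c) := by
        by_cases ha : G.hit k (G.parentA p) z = 0
        · by_cases hb : G.hit k (G.parentB p) z = 0
          · rw [G.hit_of_lt hkp, ha, hb] at h; simp at h
          · exact ⟨_, b1, h2 hb⟩
        · exact ⟨_, a1, h1 ha⟩
      have hpc : G.pathDist p c ≤ lam ^ G.gen p := by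
        have := G.pathDist_le_weight c1
        rwa [weight, max_eq_left c2.le] at this
      have hmono : ∀ i, i < G.gen p → lam ^ G.gen p ≤
          (lam ^ (i + 1) - lam ^ (G.gen p + 1)) / (1 - lam) := fun i hi => by
        rw [le_div_iff₀ hl]
        have : lam ^ G.gen p ≤ lam ^ (i + 1) := pow_le_pow_of_le_one hp.le G.lam_lt_one.le hi
        linarith [pow_succ lam (G.gen p)]
      rcases hc with ⟨rfl, -⟩ | ⟨hc, -⟩
      · exact hpc.trans (hmono k hkp)
      · calc G.pathDist p z ≤ G.pathDist p c + G.pathDist c z := G.pathDist_triangle _ _ _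
          _ ≤ _ := add_le_add (hpc.trans (hmono _ c2)) hc
          _ = _ := by ring
  rcases key with ⟨rfl, -⟩ | ⟨h, -⟩
  · rw [G.pathDist_self]; positivity
  · refine h.trans (div_le_div_of_nonneg_right ?_ hl.le)
    linarith [pow_pos hp (G.gen p + 1)]

/-- The hitting distributions of `p` and `q` are within `1/4` of each other at the vertices of
generation `k`. -/
def CloseAt (p q : V) (k : ℕ) : Prop := ∀ v, G.gen v = k → |G.hit k p v - G.hit k q v| ≤ 1 / 4

theorem eq_of_hit_ge {p q : V} {k : ℕ} (h : ∀ j ≤ k, G.CloseAt p q j) {u w : V}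
    (hu : 3 / 4 ≤ G.hit k p u) (hw : 3 / 4 ≤ G.hit k q w) : u = w := by
  induction k with
  | zero =>
    by_contra huw
    have h1 := G.gen_le_of_hit_ne_zero (k := 0) (p := p) (v := u) (by linarith)
    have h2 := abs_le.1 (h 0 le_rfl u (by omega))
    linarith [G.hit_add_hit_le_one 0 q huw]
  | succ k ih =>
    by_contra huw
    have hgu := G.gen_le_of_hit_ne_zero (k := k + 1) (p := p) (v := u) (by linarith)
    have hgw := G.gen_le_of_hit_ne_zero (k := k + 1) (p := q) (v := w) (by linarith)
    by_cases h1 : G.gen u = k + 1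
    · have h2 := abs_le.1 (h _ le_rfl u h1)
      linarith [G.hit_add_hit_le_one (k + 1) q huw]
    · by_cases h2 : G.gen w = k + 1
      · have h3 := abs_le.1 (h _ le_rfl w h2)
        linarith [G.hit_add_hit_le_one (k + 1) p huw]
      · exact huw (ih (fun j hj => h j (by omega))
          (hu.trans (G.hit_le_hit_of_le (by omega) (by omega)))
          (hw.trans (G.hit_le_hit_of_le (by omega) (by omega))))

/-- Two vertices that are close at all generations up to `k` share a vertex in the supports of
their hitting distributions. -/
theorem exists_common_of_closeAt {p q : V} {k : ℕ} (hk : k ≤ n)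
    (h : ∀ j ≤ k, G.CloseAt p q j) : ∃ z, G.hit k p z ≠ 0 ∧ G.hit k q z ≠ 0 := by
  classical
  by_cases hp : ∃ v, G.gen v = k ∧ 1 / 4 < G.hit k p v
  · obtain ⟨v, hv, hpv⟩ := hp
    have := abs_le.1 (h k le_rfl v hv)
    exact ⟨v, by linarith, by linarith⟩
  by_cases hq : ∃ v, G.gen v = k ∧ 1 / 4 < G.hit k q v
  · obtain ⟨v, hv, hqv⟩ := hq
    have := abs_le.1 (h k le_rfl v hv)
    exact ⟨v, by linarith, by linarith⟩
  push Not at hp hq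
  rcases Nat.eq_zero_or_pos k with rfl | hpos
  · obtain ⟨a, b, hab, hg, hs⟩ := G.exists_hit_zero_eq
    obtain ⟨s, hs⟩ := hs p
    have ha := hp a ((hg a).2 (Or.inl rfl))
    have hb := hp b ((hg b).2 (Or.inr rfl))
    rw [hs] at ha hb
    simp [hab, hab.symm] at ha hb
    linarith
  · have aux : ∀ r : V, (∀ v, G.gen v = k → G.hit k r v ≤ 1 / 4) → ∃ u, 3 / 4 ≤ G.hit k r u := by
      intro r hr
      obtain ⟨u, w, s, -, -, hu, hw, hs⟩ := G.exists_hit_eq hpos.ne' hk r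
      have huw : u ≠ w := by rintro rfl; omega
      have h1 := hr w hw
      refine ⟨u, ?_⟩
      rw [hs] at h1 ⊢
      simp [huw, huw.symm] at h1 ⊢
      linarith
    obtain ⟨u, hu⟩ := aux p hp
    obtain ⟨w, hw⟩ := aux q hq
    have := G.eq_of_hit_ge h hu hw
    subst this
    exact ⟨u, by linarith, by linarith⟩

/-- Distinct vertices fail to be close at some generation `k`, which bounds their distance. -/
theorem exists_not_closeAt {p q : V} (hpq : p ≠ q) :
    ∃ k ≤ n, ¬ G.CloseAt p q k ∧ G.pathDist p q ≤ 2 / (1 - lam) * lam ^ k := by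
  classical
  have hl := sub_pos.2 G.lam_lt_one
  have hex : ∃ k, k ≤ n ∧ ¬ G.CloseAt p q k := by
    by_contra! hall
    obtain ⟨z, hpz, hqz⟩ := G.exists_common_of_closeAt le_rfl hall
    have h1 : z = p := by
      by_contra h
      exact hpz (G.hit_of_ne (G.gen_le p) h)
    have h2 : z = q := by
      by_contra h
      exact hqz (G.hit_of_ne (G.gen_le q) h)
    exact hpq (h1.symm.trans h2)
  refine ⟨Nat.find hex, (Nat.find_spec hex).1, (Nat.find_spec hex).2, ?_⟩
  have hkn := (Nat.find_spec hex).1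
  have hmin : ∀ j < Nat.find hex, G.CloseAt p q j := fun j hj => by
    by_contra h
    exact Nat.find_min hex hj ⟨hj.le.trans hkn, h⟩
  generalize Nat.find hex = k at hkn hmin
  cases k with
  | zero =>
    obtain ⟨a, b, hab, hg, hs⟩ := G.exists_hit_zero_eq
    have aux : ∀ r : V, ∃ z, G.gen z = 0 ∧ G.hit 0 r z ≠ 0 := by
      intro r
      obtain ⟨s, hs⟩ := hs r
      by_cases h : s = 0
      · exact ⟨a, (hg a).2 (Or.inl rfl), by rw [hs]; simp [h]⟩
      · exact ⟨b, (hg b).2 (Or.inr rfl), by rw [hs]; simp [h, hab.symm]⟩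
    obtain ⟨z, hz, hpz⟩ := aux p
    obtain ⟨w, hw, hqw⟩ := aux q
    have h1 := G.pathDist_le_of_hit_ne_zero hpz
    have h2 := G.pathDist_le_of_hit_ne_zero hqw
    have h3 : G.pathDist z w ≤ 1 := by
      by_cases hzw : z = w
      · rw [hzw, G.pathDist_self]; exact zero_le_one
      · have := G.pathDist_le_weight (G.adj_of_gen_zero z w hz hw hzw)
        simpa [weight, hz, hw] using this
    rw [G.pathDist_comm] at h2
    have h4 : lam ^ (0 + 1) / (1 - lam) + 1 + lam ^ (0 + 1) / (1 - lam) ≤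
        2 / (1 - lam) * lam ^ 0 := by
      have : lam ^ (0 + 1) / (1 - lam) + 1 + lam ^ (0 + 1) / (1 - lam) =
          (1 + lam) / (1 - lam) := by field_simp; ring
      rw [this, pow_zero, mul_one]
      exact div_le_div_of_nonneg_right (by linarith [G.lam_lt_one]) hl.le
    linarith [G.pathDist_triangle p z q, G.pathDist_triangle z w q]
  | succ k =>
    obtain ⟨z, hpz, hqz⟩ := G.exists_common_of_closeAt (k := k) (by omega)
      fun j hj => hmin j (by omega)
    have h1 := G.pathDist_le_of_hit_ne_zero hpz
    have h2 := G.pathDist_le_of_hit_ne_zero hqz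
    rw [G.pathDist_comm] at h2
    calc _ ≤ _ := G.pathDist_triangle p z q
      _ ≤ _ := add_le_add h1 h2
      _ = _ := by ring

end Coral


/-! ### Separated points on spheres of normed spaces -/

section Sphere

open Module MeasureTheory Metric

variable {E : Type*} [NormedAddCommGroup E] [NormedSpace ℝ E] [FiniteDimensional ℝ E]

theorem exists_unit_far_of_card_lt (hd : 2 ≤ finrank ℝ E) (S : Finset E)
    (hS : S.card < 4 ^ finrank ℝ E) :
    ∃ y : E, ‖y‖ = 1 ∧ ∀ s ∈ S, 1 / 128 ≤ ‖y - s‖ := by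
  classical
  by_contra! hcon
  let _ : MeasurableSpace E := borel E
  have : BorelSpace E := ⟨rfl⟩
  set d := finrank ℝ E with hdef
  have : Nontrivial E := nontrivial_of_finrank_pos (R := ℝ) (by omega)
  let μ : Measure E := Measure.addHaar
  -- Each segment `[0, s]` is covered by balls centred at its points that divide it evenly.
  have hcov : ball (0 : E) 1 ⊆ ⋃ i ∈ S ×ˢ Finset.range 129,
      closedBall (((i.2 : ℝ) / 128) • i.1) (1 / 64) := by
    intro x hx
    rw [mem_ball_zero_iff] at hx
    obtain ⟨y, hy, hxy⟩ : ∃ y : E, ‖y‖ = 1 ∧ x = ‖x‖ • y := by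
      by_cases hx0 : x = 0
      · obtain ⟨y, hy⟩ := _root_.exists_norm_eq E zero_le_one
        exact ⟨y, hy, by simp [hx0]⟩
      · have h0 : ‖x‖ ≠ 0 := norm_ne_zero_iff.2 hx0
        exact ⟨‖x‖⁻¹ • x, by rw [norm_smul, norm_inv, norm_norm, inv_mul_cancel₀ h0],
          by rw [smul_smul, mul_inv_cancel₀ h0, one_smul]⟩
    obtain ⟨s, hs, hys⟩ := hcon y hy
    have hsn : ‖s‖ ≤ 2 := by
      have := norm_sub_norm_le s y
      rw [norm_sub_rev] at this
      linarith
    have hr0 : (0 : ℝ) ≤ ‖x‖ * 128 := by positivity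
    have hfl := Nat.floor_le hr0
    have hfl' := Nat.lt_floor_add_one (‖x‖ * 128)
    have hj : ⌊‖x‖ * 128⌋₊ < 129 := by
      rw [Nat.floor_lt hr0]; push_cast; linarith
    simp only [Set.mem_iUnion]
    refine ⟨(s, ⌊‖x‖ * 128⌋₊), Finset.mem_product.2 ⟨hs, Finset.mem_range.2 hj⟩, ?_⟩
    rw [mem_closedBall, dist_eq_norm]
    set j : ℝ := (⌊‖x‖ * 128⌋₊ : ℝ)
    have hdec : x - (j / 128) • s = (j / 128) • (y - s) + (‖x‖ - j / 128) • y := by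
      rw [smul_sub, sub_smul, ← hxy]; abel
    have hj0 : 0 ≤ j / 128 := by positivity
    calc ‖x - (j / 128) • s‖ ≤ ‖(j / 128) • (y - s)‖ + ‖(‖x‖ - j / 128) • y‖ := by
          rw [hdec]; exact norm_add_le _ _
      _ = (j / 128) * ‖y - s‖ + |‖x‖ - j / 128| := by
          rw [norm_smul, norm_smul, hy, mul_one, Real.norm_eq_abs, Real.norm_eq_abs,
            abs_of_nonneg hj0]
      _ ≤ 1 * (1 / 128) + 1 / 128 := by
          refine add_le_add (mul_le_mul (by linarith) hys.le (norm_nonneg _) zero_le_one) ?_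
          rw [abs_le]; constructor <;> linarith
      _ = 1 / 64 := by norm_num
  have hμ : μ.real (ball 0 1) ≤ S.card * 129 * (1 / 64) ^ d * μ.real (ball 0 1) := by
    calc μ.real (ball 0 1)
        ≤ μ.real (⋃ i ∈ S ×ˢ Finset.range 129,
            closedBall (((i.2 : ℝ) / 128) • i.1) (1 / 64)) := by
          refine measureReal_mono hcov (ne_of_lt ?_)
          exact measure_biUnion_lt_top (Finset.finite_toSet _) fun _ _ => measure_closedBall_lt_top
      _ ≤ ∑ i ∈ S ×ˢ Finset.range 129,
            μ.real (closedBall (((i.2 : ℝ) / 128) • i.1) (1 / 64)) :=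
          measureReal_biUnion_finset_le _ _
      _ = _ := by
          simp only [μ.addHaar_real_closedBall _ (show (0 : ℝ) ≤ 1 / 64 by norm_num),
            Finset.sum_const, Finset.card_product, Finset.card_range, nsmul_eq_mul, ← hdef]
          push_cast
          ring
  have hpos : 0 < μ.real (ball 0 1) := by
    rw [measureReal_def]
    exact ENNReal.toReal_pos (measure_ball_pos μ 0 zero_lt_one).ne' measure_ball_lt_top.ne
  have h1 : 1 ≤ (S.card : ℝ) * 129 * (1 / 64) ^ d := by
    by_contra! h
    nlinarith
  have h2 : (S.card : ℝ) ≤ 4 ^ d := by exact_mod_cast hS.le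
  have h3 : (S.card : ℝ) * 129 * (1 / 64) ^ d ≤ 129 * (1 / 16) ^ d := by
    calc (S.card : ℝ) * 129 * (1 / 64) ^ d ≤ 4 ^ d * 129 * (1 / 64) ^ d := by gcongr
      _ = 129 * (4 * (1 / 64)) ^ d := by rw [mul_pow]; ring
      _ = _ := by norm_num
  have h4 : (1 / 16 : ℝ) ^ d ≤ (1 / 16) ^ 2 :=
    pow_le_pow_of_le_one (by norm_num) (by norm_num) hd
  norm_num at h4
  linarith

/-- Separated points on the unit sphere: two antipodal points if the dimension is positive, and
`4 ^ d` points by a volume argument if the dimension `d` is at least two. -/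
theorem exists_separated_units (m : ℕ)
    (hm : m ≤ 2 ∧ 1 ≤ finrank ℝ E ∨ m ≤ 4 ^ finrank ℝ E ∧ 2 ≤ finrank ℝ E) :
    ∃ S : Finset E, S.card = m ∧ (∀ y ∈ S, ‖y‖ = 1) ∧
      ∀ y ∈ S, ∀ z ∈ S, y ≠ z → 1 / 128 ≤ ‖y - z‖ := by
  classical
  rcases hm with ⟨hm, hd⟩ | ⟨hm, hd⟩
  · have : Nontrivial E := nontrivial_of_finrank_pos (R := ℝ) (by omega)
    obtain ⟨y, hy⟩ := _root_.exists_norm_eq E zero_le_one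
    have h2 : ‖y - -y‖ = 2 := by
      rw [sub_neg_eq_add, ← two_smul ℝ y, norm_smul, hy]; norm_num
    have h2' : ‖-y - y‖ = 2 := by rw [norm_sub_rev, h2]
    have hne : y ≠ -y := by
      intro h
      rw [← h, sub_self, norm_zero] at h2
      norm_num at h2
    obtain ⟨S, hS, hcard⟩ := Finset.exists_subset_card_eq (s := ({y, -y} : Finset E))
      (hm.trans_eq (Finset.card_pair hne).symm)
    have hmem : ∀ z ∈ S, z = y ∨ z = -y := fun z hz => by simpa using hS hz
    refine ⟨S, hcard, fun z hz => ?_, fun z hz w hw hzw => ?_⟩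
    · rcases hmem z hz with rfl | rfl
      · exact hy
      · rw [norm_neg, hy]
    · rcases hmem z hz with rfl | rfl <;> rcases hmem w hw with rfl | rfl
      · exact absurd rfl hzw
      · rw [h2]; norm_num
      · rw [h2']; norm_num
      · exact absurd rfl hzw
  · induction m with
    | zero => exact ⟨∅, by simp⟩
    | succ m ih =>
      obtain ⟨S, hcard, hS, hsep⟩ := ih (by omega)
      obtain ⟨y, hy, hyS⟩ := exists_unit_far_of_card_lt hd S (by omega)
      have hyn : y ∉ S := fun h => by
        have := hyS y h
        norm_num at this
      refine ⟨insert y S, by rw [Finset.card_insert_of_notMem hyn, hcard], fun z hz => ?_,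
        fun z hz w hw hzw => ?_⟩
      · rcases Finset.mem_insert.1 hz with rfl | hz
        · exact hy
        · exact hS z hz
      · rcases Finset.mem_insert.1 hz with rfl | hz' <;>
          rcases Finset.mem_insert.1 hw with rfl | hw'
        · exact absurd rfl hzw
        · exact hyS w hw'
        · rw [norm_sub_rev]; exact hyS z hz'
        · exact hsep z hz' w hw' hzw

end Sphere

theorem coralL_spec (m : ℕ) : m ≤ 2 ∧ 1 ≤ coralL m ∨ m ≤ 4 ^ coralL m ∧ 2 ≤ coralL m := by
  unfold coralL
  split_ifs with h1 h2
  · exact Or.inl ⟨h1, le_rfl⟩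
  · exact Or.inr ⟨h2.trans (by norm_num), le_rfl⟩
  · right
    have hm : (0 : ℝ) < m := by
      have : 0 < m := by omega
      exact_mod_cast this
    constructor
    · have h := Nat.le_ceil (Real.logb 4 m)
      rw [Real.logb_le_iff_le_rpow (by norm_num) hm, Real.rpow_natCast] at h
      exact_mod_cast h
    · rw [Nat.succ_le_iff, Nat.lt_ceil, Nat.cast_one,
        Real.lt_logb_iff_rpow_lt (by norm_num) hm, Real.rpow_one]
      have : 4 < m := by omega
      exact_mod_cast this

/-- For distinct points of a `1/128`-separated set on the sphere, nonnegative multiples of norm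
`s` and `t` can only be close if `s` and `t` are both small. -/
theorem le_norm_smul_sub_smul {X : Type*} [NormedAddCommGroup X] [NormedSpace ℝ X] {y z : X}
    (hy : ‖y‖ = 1) (hz : ‖z‖ = 1) (hyz : 1 / 128 ≤ ‖y - z‖) {s t : ℝ} (hs : 0 ≤ s) (ht : 0 ≤ t) :
    s / 256 ≤ ‖s • y - t • z‖ := by
  have h1 : |s - t| ≤ ‖s • y - t • z‖ := by
    have := abs_norm_sub_norm_le (s • y) (t • z)
    rwa [norm_smul, norm_smul, hy, hz, mul_one, mul_one, Real.norm_of_nonneg hs,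
      Real.norm_of_nonneg ht] at this
  have h2 : s * ‖y - z‖ ≤ ‖s • y - t • z‖ + |s - t| := by
    calc s * ‖y - z‖ = ‖(s • y - t • z) - (s - t) • z‖ := by
          rw [← Real.norm_of_nonneg hs, ← norm_smul, Real.norm_of_nonneg hs]
          congr 1
          rw [smul_sub, sub_smul]; abel
      _ ≤ _ := (norm_sub_le _ _).trans_eq (by rw [norm_smul, hz, mul_one, Real.norm_eq_abs])
  nlinarith

/-! ### Blocks of a basic sequence -/

theorem IsBasicSequence.restrictScalars {𝕜 : Type*} [RCLike 𝕜] {X : Type*} [NormedAddCommGroup X]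
    [NormedSpace 𝕜 X] [NormedSpace ℝ X] [IsScalarTower ℝ 𝕜 X] {C : ℝ} {l : ℕ} {x : Fin l → X}
    (h : IsBasicSequence 𝕜 C x) : IsBasicSequence ℝ C x := by
  refine ⟨h.1.restrict_scalars' ℝ, fun m a => ?_⟩
  have key : ∀ i, (algebraMap ℝ 𝕜 (a i)) • x i = a i • x i := fun i => algebraMap_smul 𝕜 (a i) (x i)
  simpa only [key] using h.2 m fun i => algebraMap ℝ 𝕜 (a i)

/-- Consecutive blocks of lengths `L 0, …, L n` of a basic sequence span subspaces of these
dimensions, the projections onto which have norm at most twice the basis constant. -/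
theorem IsBasicSequence.exists_blocks {X : Type*} [NormedAddCommGroup X] [NormedSpace ℝ X] {C : ℝ}
    {n : ℕ} {L : ℕ → ℕ} {x : Fin (∑ i ∈ Finset.range (n + 1), L i) → X}
    (hx : IsBasicSequence ℝ C x) :
    ∃ E : ℕ → Submodule ℝ X,
      (∀ k ≤ n, FiniteDimensional ℝ (E k) ∧ Module.finrank ℝ (E k) = L k) ∧
      ∀ z : ℕ → X, (∀ k ≤ n, z k ∈ E k) →
        ∀ k ≤ n, ‖z k‖ ≤ 2 * C * ‖∑ j ∈ Finset.range (n + 1), z j‖ := by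
  classical
  set S : ℕ → ℕ := fun k => ∑ i ∈ Finset.range k, L i with hSdef
  have hS : ∀ k, S (k + 1) = S k + L k := fun k => Finset.sum_range_succ _ _
  have hSmono : Monotone S := monotone_nat_of_le_succ fun k => by rw [hS]; omega
  have hlt : ∀ k ≤ n, ∀ j : Fin (L k), S k + j < ∑ i ∈ Finset.range (n + 1), L i := by
    intro k hk j
    have h1 : S (k + 1) ≤ S (n + 1) := hSmono (by omega)
    have h2 := j.2
    rw [hS k] at h1
    exact lt_of_lt_of_le (by omega) h1
  let e : ∀ k, k ≤ n → Fin (L k) → Fin (∑ i ∈ Finset.range (n + 1), L i) :=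
    fun k hk j => ⟨S k + j, hlt k hk j⟩
  have hinj : ∀ k hk, Function.Injective (e k hk) := fun k hk i j hij => by
    have := congrArg Fin.val hij
    simp only [e] at this
    exact Fin.ext (by omega)
  refine ⟨fun k => if hk : k ≤ n then Submodule.span ℝ (Set.range fun j => x (e k hk j)) else ⊥,
    fun k hk => ?_, fun z hz => ?_⟩
  · beta_reduce
    rw [dif_pos hk]
    exact ⟨FiniteDimensional.span_of_finite ℝ (Set.finite_range _),
      (finrank_span_eq_card (hx.1.comp _ (hinj k hk))).trans (Fintype.card_fin _)⟩
  -- The coefficients of `z k`, supported in the `k`-th block.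
  have hcoef : ∀ k, ∃ a : Fin (∑ i ∈ Finset.range (n + 1), L i) → ℝ,
      k ≤ n → z k = ∑ i, a i • x i ∧ ∀ i, a i ≠ 0 → S k ≤ i.val ∧ i.val < S (k + 1) := by
    intro k
    by_cases hk : k ≤ n
    · have hzk := hz k hk
      simp only [dif_pos hk, Submodule.mem_span_range_iff_exists_fun] at hzk
      obtain ⟨c, hc⟩ := hzk
      refine ⟨fun i => ∑ j, if e k hk j = i then c j else 0, fun _ => ⟨?_, fun i hi => ?_⟩⟩
      · rw [← hc]
        simp only [Finset.sum_smul, ite_smul, zero_smul]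
        rw [Finset.sum_comm]
        simp
      · obtain ⟨j, -, hj⟩ := Finset.exists_ne_zero_of_sum_ne_zero hi
        have hji : e k hk j = i := by
          by_contra h
          simp [h] at hj
        rw [← hji, hS]
        have := j.2
        simp only [e]
        omega
    · exact ⟨0, fun h => absurd h hk⟩
  choose a ha using hcoef
  have hsum : ∀ m ≤ n + 1, ∑ i with i.val < S m, (∑ k ∈ Finset.range (n + 1), a k i) • x i =
      ∑ k ∈ Finset.range m, z k := by
    intro m hm
    simp only [Finset.sum_smul]
    rw [Finset.sum_comm, ← Finset.sum_subset (Finset.range_mono hm)]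
    · refine Finset.sum_congr rfl fun k hk => ?_
      rw [Finset.mem_range] at hk
      obtain ⟨h1, h2⟩ := ha k (by omega)
      rw [h1]
      refine Finset.sum_subset (Finset.subset_univ _) fun i _ hi => ?_
      rw [Finset.mem_filter] at hi
      by_contra h
      have h3 := h2 i fun h0 => h (by rw [h0, zero_smul])
      exact hi ⟨Finset.mem_univ _, h3.2.trans_le (hSmono hk)⟩
    · intro k hk hkm
      rw [Finset.mem_range] at hk hkm
      obtain ⟨-, h2⟩ := ha k (by omega)
      refine Finset.sum_eq_zero fun i hi => ?_
      rw [Finset.mem_filter] at hi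
      by_contra h
      have h3 := h2 i fun h0 => h (by rw [h0, zero_smul])
      have h4 : S m ≤ S k := hSmono (by omega)
      omega
  have htot : ∑ i, (∑ k ∈ Finset.range (n + 1), a k i) • x i =
      ∑ k ∈ Finset.range (n + 1), z k := by
    rw [← hsum (n + 1) le_rfl]
    refine (Finset.sum_subset (Finset.subset_univ _) fun i _ hi => absurd ?_ hi).symm
    exact Finset.mem_filter.2 ⟨Finset.mem_univ _, i.2⟩
  have hpart : ∀ m ≤ n + 1, ‖∑ k ∈ Finset.range m, z k‖ ≤
      C * ‖∑ k ∈ Finset.range (n + 1), z k‖ := fun m hm => by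
    rw [← hsum m hm, ← htot]; exact hx.2 _ _
  intro k hk
  have hzk : z k = ∑ j ∈ Finset.range (k + 1), z j - ∑ j ∈ Finset.range k, z j := by
    rw [Finset.sum_range_succ]; abel
  calc ‖z k‖ ≤ ‖∑ j ∈ Finset.range (k + 1), z j‖ + ‖∑ j ∈ Finset.range k, z j‖ := by
        rw [hzk]; exact norm_sub_le _ _
    _ ≤ _ := add_le_add (hpart _ (by omega)) (hpart _ (by omega))
    _ = _ := by ring

/-! ### The embedding -/

namespace Coral

variable {lam : ℝ} {n : ℕ} {N : ℕ → ℕ} {V : Type*} (G : Coral lam n N V)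

theorem finite_gen_eq {k : ℕ} (hk : k ≤ n) : {v | G.gen v = k}.Finite :=
  Set.finite_of_ncard_ne_zero (G.ncard_gen_ne_zero hk)

theorem finite (G : Coral lam n N V) : Finite V := by
  refine Set.finite_univ_iff.1 (((Set.finite_Iic n).biUnion fun k hk =>
    G.finite_gen_eq hk).subset fun v _ => ?_)
  exact Set.mem_biUnion (Set.mem_Iic.2 (G.gen_le v)) rfl

variable {X : Type*} [NormedAddCommGroup X] [NormedSpace ℝ X]

/-- Separated unit vectors can be assigned to the vertices of each generation, within prescribed
subspaces of dimensions `coralL (N k)`. -/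
theorem exists_separated_vectors {E : ℕ → Submodule ℝ X}
    (hE : ∀ k ≤ n, FiniteDimensional ℝ (E k) ∧ Module.finrank ℝ (E k) = coralL (N k)) :
    ∃ y : V → X, (∀ v, y v ∈ E (G.gen v)) ∧ (∀ v, ‖y v‖ = 1) ∧
      ∀ u v, u ≠ v → G.gen u = G.gen v → 1 / 128 ≤ ‖y u - y v‖ := by
  have key : ∀ k, ∃ g : V → X, k ≤ n → ∀ v, G.gen v = k → g v ∈ E k ∧ ‖g v‖ = 1 ∧
      ∀ u, G.gen u = k → u ≠ v → 1 / 128 ≤ ‖g u - g v‖ := by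
    intro k
    by_cases hk : k ≤ n
    · obtain ⟨hfin, hrank⟩ := hE k hk
      obtain ⟨S, hcard, hS, hsep⟩ := exists_separated_units (E := E k) (N k)
        (hrank ▸ coralL_spec (N k))
      have hfinite := G.finite_gen_eq hk
      have hcard' : hfinite.toFinset.card = S.card := by
        rw [← Set.ncard_eq_toFinset_card _ hfinite, G.card_gen k hk, hcard]
      let e := Finset.equivOfCardEq hcard'
      classical
      have hm : ∀ v, G.gen v = k → v ∈ hfinite.toFinset := fun v hv => by simpa using hv
      refine ⟨fun v => if h : v ∈ hfinite.toFinset then ((e ⟨v, h⟩ : E k) : X) else 0,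
        fun _ v hv => ?_⟩
      simp only [dif_pos (hm v hv)]
      refine ⟨Subtype.coe_prop _, hS _ (e _).2, fun u hu huv => ?_⟩
      rw [dif_pos (hm u hu)]
      refine hsep _ (e _).2 _ (e _).2 fun h => huv ?_
      exact congrArg Subtype.val (e.injective (Subtype.ext h))
    · exact ⟨0, fun h => absurd h hk⟩
  choose g hg using key
  refine ⟨fun v => g (G.gen v) v, fun v => (hg _ (G.gen_le v) v rfl).1,
    fun v => (hg _ (G.gen_le v) v rfl).2.1, fun u v huv hgen => ?_⟩
  simp only [hgen]
  exact (hg _ (G.gen_le v) v rfl).2.2 u hgen huv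

variable [Fintype V] (y : V → X)

/-- The component of generation `k` of the image of `p`, up to the factor `lam ^ k`: the mean of
`y` over the hitting distribution at the vertices of generation exactly `k`. -/
def component (k : ℕ) (p : V) : X := ∑ v with G.gen v = k, G.hit k p v • y v

/-- The embedding: a vertex of `V_k`, `k ≥ 1`, is sent to the mean of the images of its parents
plus `lam ^ k` times the unit vector assigned to it (see `embed_eq`). -/
def embed (p : V) : X := ∑ k ∈ Finset.range (n + 1), lam ^ k • G.component y k p

theorem embed_eq_sum (p : V) :
    G.embed y p = ∑ v, (lam ^ G.gen v * G.hit (G.gen v) p v) • y v := by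
  rw [← Finset.sum_fiberwise_of_maps_to (s := Finset.univ) (t := Finset.range (n + 1)) (g := G.gen)
    (fun v _ => Finset.mem_range.2 (Nat.lt_succ_of_le (G.gen_le v)))]
  refine Finset.sum_congr rfl fun k _ => ?_
  rw [component, Finset.smul_sum]
  refine Finset.sum_congr rfl fun v hv => ?_
  rw [(Finset.mem_filter.1 hv).2, smul_smul]

theorem embed_of_gen_eq_zero {p : V} (hp : G.gen p = 0) : G.embed y p = y p := by
  rw [embed_eq_sum, Finset.sum_eq_single p]
  · rw [G.hit_self le_rfl, hp]; simp
  · intro v _ hv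
    rw [G.hit_of_ne (by omega) hv]; simp
  · simp

theorem embed_eq {p : V} (hp : G.gen p ≠ 0) : G.embed y p =
    (1 / 2 : ℝ) • (G.embed y (G.parentA p) + G.embed y (G.parentB p)) + lam ^ G.gen p • y p := by
  classical
  obtain ⟨⟨-, ha⟩, ⟨-, hb⟩, -⟩ := G.parents_spec hp
  have hsingle : lam ^ G.gen p • y p = ∑ v, if v = p then lam ^ G.gen v • y v else 0 := by simp
  rw [hsingle]
  simp only [embed_eq_sum]
  rw [← Finset.sum_add_distrib, Finset.smul_sum, ← Finset.sum_add_distrib]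
  refine Finset.sum_congr rfl fun v _ => ?_
  by_cases hv : G.gen p ≤ G.gen v
  · rw [G.hit_of_ne (p := G.parentA p) (by omega) (by rintro h; rw [h] at hv; omega),
      G.hit_of_ne (p := G.parentB p) (by omega) (by rintro h; rw [h] at hv; omega)]
    by_cases hvp : v = p
    · rw [if_pos hvp, hvp, G.hit_self le_rfl]; simp
    · rw [if_neg hvp, G.hit_of_ne hv hvp]; simp
  · rw [if_neg (by rintro rfl; exact hv le_rfl), G.hit_of_lt (not_le.1 hv), ← add_smul, smul_smul,
      add_zero]
    congr 1
    ring

variable {y}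

/-- The ends of an edge of weight `w` are mapped to points at distance at most
`2 * lam / (2 * lam - 1) * w`: this constant `A` solves `A / 2 + lam = A * lam`. -/
theorem norm_embed_sub_le_weight (hy : ∀ v, ‖y v‖ = 1) {u w : V} (huw : G.graph.Adj u w) :
    ‖G.embed y u - G.embed y w‖ ≤ 2 * lam / (2 * lam - 1) * G.weight u w := by
  have hl : 0 < 2 * lam - 1 := by linarith [G.lam_mem.1]
  have hl1 := G.lam_lt_one
  have hl0 := G.lam_pos
  have hA : 2 ≤ 2 * lam / (2 * lam - 1) := by rw [le_div_iff₀ hl]; linarith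
  have hA' : 2 * lam / (2 * lam - 1) / 2 + lam = 2 * lam / (2 * lam - 1) * lam := by
    field_simp; ring
  set A := 2 * lam / (2 * lam - 1)
  induction h : max (G.gen u) (G.gen w) using Nat.strong_induction_on generalizing u w with
  | _ j ih =>
    wlog hle : G.gen u ≤ G.gen w generalizing u w
    · rw [norm_sub_rev, weight, max_comm]
      exact this huw.symm (by rwa [max_comm]) (by omega)
    rw [weight, max_eq_right hle]
    by_cases hw : G.gen w = 0
    · rw [G.embed_of_gen_eq_zero y hw, G.embed_of_gen_eq_zero y (by omega), hw, pow_zero, mul_one]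
      refine (norm_sub_le _ _).trans ?_
      rw [hy, hy]; linarith
    have hlt : G.gen u < G.gen w := lt_of_le_of_ne hle (G.gen_ne_of_adj w u huw.symm hw).symm
    obtain ⟨⟨a1, a2⟩, ⟨b1, b2⟩, hall⟩ := G.parents_spec hw
    obtain ⟨c, c1, c2, hc⟩ : ∃ c, G.graph.Adj w c ∧ G.gen c < G.gen w ∧
        G.embed y w = (1 / 2 : ℝ) • (G.embed y u + G.embed y c) + lam ^ G.gen w • y w := by
      rcases hall u huw.symm hlt with rfl | rfl
      · exact ⟨_, b1, b2, G.embed_eq y hw⟩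
      · exact ⟨_, a1, a2, by rw [G.embed_eq y hw, add_comm (G.embed y (G.parentA w))]⟩
    obtain ⟨m, hm⟩ := Nat.exists_eq_succ_of_ne_zero hw
    have huc : ‖G.embed y u - G.embed y c‖ ≤ A * lam ^ m := by
      by_cases huc : u = c
      · rw [huc, sub_self, norm_zero]; positivity
      · obtain ⟨h1, h2⟩ := G.adj_of_attached w u c huc huw.symm hlt c1 c2
        have h3 : max (G.gen u) (G.gen c) = m := by omega
        have := ih _ (by omega) h1 h3
        rwa [weight, h3] at this
    have hdec : G.embed y u - G.embed y w =
        (1 / 2 : ℝ) • (G.embed y u - G.embed y c) - lam ^ G.gen w • y w := by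
      rw [hc]; module
    calc ‖G.embed y u - G.embed y w‖
        ≤ ‖(1 / 2 : ℝ) • (G.embed y u - G.embed y c)‖ + ‖lam ^ G.gen w • y w‖ := by
          rw [hdec]; exact norm_sub_le _ _
      _ = 1 / 2 * ‖G.embed y u - G.embed y c‖ + lam ^ (m + 1) := by
          rw [norm_smul, norm_smul, hy, mul_one, hm, Real.norm_of_nonneg (by norm_num),
            Real.norm_of_nonneg (by positivity)]
      _ ≤ 1 / 2 * (A * lam ^ m) + lam ^ (m + 1) := by gcongr
      _ = (A / 2 + lam) * lam ^ m := by ring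
      _ = A * lam ^ G.gen w := by rw [hA', hm, pow_succ]; ring

theorem norm_embed_sub_le (hy : ∀ v, ‖y v‖ = 1) (p q : V) :
    ‖G.embed y p - G.embed y q‖ ≤ 2 * lam / (2 * lam - 1) * G.pathDist p q := by
  have hl : 0 < 2 * lam - 1 := by linarith [G.lam_mem.1]
  have hA : 0 < 2 * lam / (2 * lam - 1) := div_pos (by linarith [G.lam_pos]) hl
  have hwalk : ∀ {u v : V} (w : G.graph.Walk u v),
      ‖G.embed y u - G.embed y v‖ ≤ 2 * lam / (2 * lam - 1) * G.walkLength w := by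
    intro u v w
    induction w with
    | nil => simp [walkLength]
    | @cons a b c hab w ih =>
      have hlen : G.walkLength (SimpleGraph.Walk.cons hab w) = G.weight a b + G.walkLength w := by
        simp [walkLength]
      rw [hlen, mul_add]
      exact (norm_sub_le_norm_sub_add_norm_sub _ (G.embed y b) _).trans
        (add_le_add (G.norm_embed_sub_le_weight hy hab) ih)
  rw [← div_le_iff₀' hA]
  exact le_ciInf fun w => (div_le_iff₀' hA).2 (hwalk w)

theorem le_norm_component_sub (hy : ∀ v, ‖y v‖ = 1)
    (hsep : ∀ u v, u ≠ v → G.gen u = G.gen v → 1 / 128 ≤ ‖y u - y v‖) {p q : V} {k : ℕ}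
    (hk : k ≤ n) (h : ¬ G.CloseAt p q k) :
    1 / 1024 ≤ ‖G.component y k p - G.component y k q‖ := by
  classical
  simp only [CloseAt, not_forall, not_le] at h
  obtain ⟨v, hv, hlt⟩ := h
  rcases Nat.eq_zero_or_pos k with rfl | hpos
  · obtain ⟨a, b, hab, hg, hs⟩ := G.exists_hit_zero_eq
    have hcomp : ∀ (r : V) (s : ℝ),
        G.hit 0 r = (1 - s) • Pi.single a (1 : ℝ) + s • Pi.single b (1 : ℝ) →
          G.component y 0 r = (1 - s) • y a + s • y b := by
      intro r s hrs
      have hfil : Finset.univ.filter (fun v => G.gen v = 0) = {a, b} := by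
        ext v; simp [hg]
      rw [component, hfil, Finset.sum_pair hab, hrs]
      simp [hab, hab.symm]
    obtain ⟨s, hp⟩ := hs p
    obtain ⟨t, hq⟩ := hs q
    have hdiff : (1 - s) • y a + s • y b - ((1 - t) • y a + t • y b) = (t - s) • (y a - y b) := by
      module
    rw [hcomp p s hp, hcomp q t hq, hdiff, norm_smul, Real.norm_eq_abs]
    have hst : 1 / 4 < |t - s| := by
      rw [hp, hq] at hlt
      rcases (hg v).1 hv with rfl | rfl
      · simpa [hab, hab.symm] using hlt
      · rw [abs_sub_comm]
        simpa [hab, hab.symm] using hlt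
    have hab' := hsep a b hab (((hg a).2 (Or.inl rfl)).trans ((hg b).2 (Or.inr rfl)).symm)
    nlinarith
  · have hcomp : ∀ (r u w : V) (s : ℝ), G.gen u < k → G.gen w = k →
        G.hit k r = (1 - s) • Pi.single u (1 : ℝ) + s • Pi.single w (1 : ℝ) →
          G.component y k r = s • y w ∧
            ∀ v, G.gen v = k → G.hit k r v = if v = w then s else 0 := by
      intro r u w s hu hw hrs
      have hval : ∀ v, G.gen v = k → G.hit k r v = if v = w then s else 0 := by
        intro v hv
        have hvu : v ≠ u := by rintro rfl; omega
        rw [hrs]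
        by_cases hvw : v = w <;> simp [hvu, hvw, Pi.single_apply]
        rintro h
        exact absurd (hvw.trans h) hvu
      refine ⟨?_, hval⟩
      rw [component, Finset.sum_eq_single_of_mem w (Finset.mem_filter.2 ⟨Finset.mem_univ _, hw⟩)]
      · rw [hval w hw, if_pos rfl]
      · intro v hv hvw
        rw [hval v (Finset.mem_filter.1 hv).2, if_neg hvw, zero_smul]
    obtain ⟨u, w, s, hs, -, hu, hw, hps⟩ := G.exists_hit_eq hpos.ne' hk p
    obtain ⟨u', w', t, ht, -, hu', hw', hqt⟩ := G.exists_hit_eq hpos.ne' hk q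
    obtain ⟨hp, hp'⟩ := hcomp p u w s hu hw hps
    obtain ⟨hq, hq'⟩ := hcomp q u' w' t hu' hw' hqt
    rw [hp' v hv, hq' v hv] at hlt
    rw [hp, hq]
    by_cases hww : w = w'
    · subst hww
      rw [← sub_smul, norm_smul, hy, mul_one, Real.norm_eq_abs]
      split_ifs at hlt
      · linarith
      · norm_num at hlt
    · have h1 := le_norm_smul_sub_smul (hy w) (hy w') (hsep w w' hww (hw.trans hw'.symm)) hs ht
      have h2 := le_norm_smul_sub_smul (hy w') (hy w)
        (hsep w' w (Ne.symm hww) (hw'.trans hw.symm)) ht hs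
      rw [norm_sub_rev] at h2
      split_ifs at hlt with h3 h4 h4
      · exact absurd (h3.symm.trans h4) hww
      · rw [sub_zero, abs_of_nonneg hs] at hlt; linarith
      · rw [zero_sub, abs_neg, abs_of_nonneg ht] at hlt; linarith
      · norm_num at hlt

theorem pathDist_le_norm_embed_sub (hy : ∀ v, ‖y v‖ = 1)
    (hsep : ∀ u v, u ≠ v → G.gen u = G.gen v → 1 / 128 ≤ ‖y u - y v‖) {C : ℝ} (hC : 0 ≤ C)
    {E : ℕ → Submodule ℝ X} (hyE : ∀ v, y v ∈ E (G.gen v))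
    (hE : ∀ z : ℕ → X, (∀ k ≤ n, z k ∈ E k) →
      ∀ k ≤ n, ‖z k‖ ≤ 2 * C * ‖∑ j ∈ Finset.range (n + 1), z j‖) (p q : V) :
    G.pathDist p q ≤ 4096 * C / (1 - lam) * ‖G.embed y p - G.embed y q‖ := by
  have hl := sub_pos.2 G.lam_lt_one
  have hl0 := G.lam_pos
  by_cases hpq : p = q
  · rw [hpq, G.pathDist_self]; positivity
  obtain ⟨k, hk, hclose, hd⟩ := G.exists_not_closeAt hpq
  have hmem : ∀ (j : ℕ) (r : V), G.component y j r ∈ E j := fun j r =>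
    Submodule.sum_mem _ fun v hv =>
      Submodule.smul_mem _ _ ((Finset.mem_filter.1 hv).2 ▸ hyE v)
  have h1 := hE (fun j => lam ^ j • G.component y j p - lam ^ j • G.component y j q)
    (fun j _ => Submodule.sub_mem _ (Submodule.smul_mem _ _ (hmem j p))
      (Submodule.smul_mem _ _ (hmem j q))) k hk
  rw [Finset.sum_sub_distrib] at h1
  simp only [← smul_sub, norm_smul, Real.norm_of_nonneg (pow_pos hl0 k).le] at h1
  have h2 := G.le_norm_component_sub hy hsep hk hclose
  have h3 : lam ^ k ≤ 2048 * C * ‖G.embed y p - G.embed y q‖ := by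
    have h4 : lam ^ k * (1 / 1024) ≤ 2 * C * ‖G.embed y p - G.embed y q‖ :=
      (mul_le_mul_of_nonneg_left h2 (pow_pos hl0 k).le).trans h1
    linarith
  calc G.pathDist p q ≤ 2 / (1 - lam) * lam ^ k := hd
    _ ≤ 2 / (1 - lam) * (2048 * C * ‖G.embed y p - G.embed y q‖) := by gcongr
    _ = _ := by ring

end Coral

theorem embedsWithDistortion_of_dist_le {X Y : Type*} [MetricSpace X] [MetricSpace Y] {A B : ℝ}
    (hA : 0 ≤ A) (f : X → Y) (h1 : ∀ x y, dist (f x) (f y) ≤ A * dist x y)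
    (h2 : ∀ x y, dist x y ≤ B * dist (f x) (f y)) : EmbedsWithDistortion (A * B) X Y := by
  refine ⟨f, fun x y hxy => ?_, ?_⟩
  · have := h2 x y
    rw [hxy, dist_self, mul_zero] at this
    exact dist_le_zero.1 this
  · have aux : ∀ {a b c : ℝ}, 0 ≤ c → a ≤ b * c →
        ENNReal.ofReal a / ENNReal.ofReal c ≤ ENNReal.ofReal b := fun hc hab =>
      ENNReal.div_le_of_le_mul ((ENNReal.ofReal_le_ofReal hab).trans_eq (ENNReal.ofReal_mul' hc))
    rw [distortion, ENNReal.ofReal_mul hA]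
    refine mul_le_mul' (iSup_le fun x => iSup_le fun y => iSup_le fun _ => ?_)
      (iSup_le fun x => iSup_le fun y => iSup_le fun _ => ?_)
    · rw [edist_dist, edist_dist]; exact aux dist_nonneg (h1 x y)
    · rw [edist_dist, edist_dist]; exact aux dist_nonneg (h2 x y)

theorem theorem4p2 (C lam : ℝ) (hC : 1 ≤ C) (hlam : lam ∈ Set.Ioo (1 / 2 : ℝ) 1) :
    ∃ D : ℝ, ∀ (n : ℕ) (N : ℕ → ℕ) (V : Type*) (G : Coral lam n N V)
      (𝕜 : Type*) [RCLike 𝕜] (X : Type*) [NormedAddCommGroup X] [NormedSpace 𝕜 X]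
      [CompleteSpace X],
      (∃ x : Fin (∑ i ∈ Finset.range (n + 1), coralL (N i)) → X, IsBasicSequence 𝕜 C x) →
        EmbedsWithDistortion D G.Points X := by
  refine ⟨2 * lam / (2 * lam - 1) * (4096 * C / (1 - lam)), ?_⟩
  rintro n N V G 𝕜 _ X _ _ _ ⟨x, hx⟩
  let _ : NormedSpace ℝ X := NormedSpace.restrictScalars ℝ 𝕜 X
  have _ : IsScalarTower ℝ 𝕜 X :=
    ⟨fun r c v => by rw [Algebra.smul_def, mul_smul]; rfl⟩
  obtain ⟨E, hE, hproj⟩ := hx.restrictScalars.exists_blocks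
  obtain ⟨y, hyE, hy, hsep⟩ := G.exists_separated_vectors hE
  have _ := G.finite
  let _ := Fintype.ofFinite V
  have hA : 0 ≤ 2 * lam / (2 * lam - 1) :=
    div_nonneg (by linarith [hlam.1]) (by linarith [hlam.1])
  refine embedsWithDistortion_of_dist_le hA (G.embed y) (fun p q => ?_) fun p q => ?_
  · rw [dist_eq_norm]
    exact G.norm_embed_sub_le hy p q
  · rw [dist_eq_norm]
    exact G.pathDist_le_norm_embed_sub hy hsep (zero_le_one.trans hC) hyE hproj p q

end
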